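/- Let $(X,\|\cdot\|)$ be a real normed space and let $\sigma$ be a Hausdorff vector topology on $X$ that is coarser than the norm topology. Assume that the closed unit ball $B_X$ is both sequentially $\sigma$-compact (assumption $(H_\sigma)$) and $\sigma$-compact. Let $K\subseteq X$ be nonempty, $\sigma$-closed and convex, and let $\psi:K\times K\to\mathbb R$. Notation. For $n\ge 1$ put $K_n=\{x\in K:\|x\|\le n\}$. For $A\subseteq K$ put $S(\psi,A)=\{x\in A:\psi(x,y)\ge 0\ \text{for all } y\in A\}$. The $\sigma$-asymptotic cone of $A\subseteq X$ is $$A^\infty_\sigma=\Big\{u\in X:\ \exists\, t_k\to+\infty,\ \exists\,(x_k)\subseteq A,\ \tfrac{x_k}{t_k}\xrightarrow{\ \sigma\ }u\Big\},\qquad \emptyset^\infty_\sigma=\emptyset .$$ For $f:K\to\mathbb R$, with sublevel sets $[f\le\lambda]=\{x\in K: f(x)\le\lambda\}$, put $f^{\sigma g}(u)=\inf\{\lambda\in\mathbb R:\ u\in([f\le\lambda])^\infty_\sigma\}\in[-\infty,+\infty]$ for $u\in X$, and let $$R^E_\sigma=\{u\in K^\infty_\sigma:\ (-\psi(\cdot,y))^{\sigma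 g}(u)\le 0\ \text{ for all } y\in K\}.$$ Assume moreover: 1. (Condition $(K_\sigma)$) for every norm-unbounded sequence $(x_n)_{n\ge1}\subseteq K$ such that $x_n\in S(\psi,K_n)$ for every $n\geq 1$ with $K_n\ne\emptyset$, there are a subsequence $(x_{n_k})$, a sequence $(w_k)\subseteq K\setminus\{0\}$ and $0\ne d\in K^\infty_\sigma$ such that, for every $k$, $\psi(x_{n_k},y)\le\psi(w_k,y)$ for all $y\in K_{n_k}$, and $\frac{w_k}{\|w_k\|}\xrightarrow{\ \sigma\ }d$; 2. $\psi(x,x)=0$ for all $x\in K$; 3. $-\psi$ is pseudomonotone on $K$: for all $x,y\in K$, $-\psi(x,y)\ge 0$ implies $-\psi(y,x)\le 0$; 4. for every $y\in K$, the function $\psi(\cdot,y)$ is quasi-concave and $\sigma$-upper semicontinuous on $K$. Then $R^E_\sigma\subseteq\{0\}$ if and only if $S(\psi,K)\neq\emptyset$ and $(S(\psi,K))^\infty_\sigma=\{0\}$. -/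

import Mathlib

open Filter Topology

namespace SigmaEP

variable {X : Type*} [NormedAddCommGroup X] [NormedSpace ℝ X]

/-- The truncation `K_n = {x ∈ K : ‖x‖ ≤ n}`. -/
def truncation (K : Set X) (n : ℕ) : Set X := {x | x ∈ K ∧ ‖x‖ ≤ n}

/-- The solution set `S(ψ, A) = {x ∈ A : ψ(x, y) ≥ 0 for all y ∈ A}` of the equilibrium
problem; only the values of `ψ` on `A × A` matter. -/
def solutionSet (ψ : X → X → ℝ) (A : Set X) : Set X := {x | x ∈ A ∧ ∀ y ∈ A, 0 ≤ ψ x y}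

/-- The asymptotic cone of `A` with respect to the topology `σ`: all `σ`-limits of sequences
`x_k / t_k` with `x_k ∈ A` and `t_k → +∞`.  (It is empty when `A` is empty.) -/
def asymptoticCone (σ : TopologicalSpace X) (A : Set X) : Set X :=
  {u | ∃ (t : ℕ → ℝ) (x : ℕ → X), Tendsto t atTop atTop ∧ (∀ k, x k ∈ A) ∧
    Tendsto (fun k => (t k)⁻¹ • x k) atTop (@nhds X σ u)}

open Classical in
/-- The extension of a real function on `K` to the whole space by `+∞` outside `K`. -/
noncomputable def extendTop (K : Set X) (f : X → ℝ) : X → EReal :=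
  fun x => if x ∈ K then (f x : EReal) else ⊤

/-- The generalized asymptotic function
`f^{σg}(u) = inf {r ∈ ℝ : u ∈ ([f ≤ r])^∞_σ}`, with values in `[-∞, +∞]`. -/
noncomputable def genAsymptotic (σ : TopologicalSpace X) (f : X → EReal) (u : X) : EReal :=
  ⨅ (r : ℝ) (_ : u ∈ asymptoticCone σ {x | f x ≤ (r : EReal)}), (r : EReal)

/-- `R_σ^E = {u ∈ K^∞_σ : (-ψ(·, y))^{σg}(u) ≤ 0 for all y ∈ K}`. -/
def recessionSet (σ : TopologicalSpace X) (K : Set X) (ψ : X → X → ℝ) : Set X :=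
  {u | u ∈ asymptoticCone σ K ∧
    ∀ y ∈ K, genAsymptotic σ (extendTop K (fun x => -ψ x y)) u ≤ 0}

/-- A bifunction is pseudomonotone on `K` if `φ(x, y) ≥ 0` implies `φ(y, x) ≤ 0`. -/
def PseudomonotoneOn (K : Set X) (φ : X → X → ℝ) : Prop :=
  ∀ x ∈ K, ∀ y ∈ K, 0 ≤ φ x y → φ y x ≤ 0

/-- Condition `(K_σ)`.  The sequence `(x_n)`, `n ≥ 1`, lies in `K`, is norm-unbounded, and
`x_n ∈ S(ψ, K_n)` for every `n ≥ 1` for which `K_n` is nonempty.  (If `K` misses a ball around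
the origin, the first few `K_n` are empty and impose nothing on `x_n`.) -/
def ConditionK (σ : TopologicalSpace X) (K : Set X) (ψ : X → X → ℝ) : Prop :=
  ∀ x : ℕ → X, (∀ n, x n ∈ K) →
    (∀ n, 1 ≤ n → (truncation K n).Nonempty → x n ∈ solutionSet ψ (truncation K n)) →
    ¬ Bornology.IsBounded (Set.range x) →
    ∃ (φ : ℕ → ℕ) (w : ℕ → X) (d : X),
      StrictMono φ ∧ (∀ k, 1 ≤ φ k) ∧ (∀ k, w k ∈ K ∧ w k ≠ 0) ∧
      d ∈ asymptoticCone σ K ∧ d ≠ 0 ∧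
      (∀ k, ∀ y ∈ truncation K (φ k), ψ (x (φ k)) y ≤ ψ (w k) y) ∧
      Tendsto (fun k => ‖w k‖⁻¹ • w k) atTop (@nhds X σ d)

end SigmaEP

/-!
For `y ∈ K` put `F y = {x ∈ K : 0 ≤ ψ x y}`; it is `σ`-closed, convex and contains `y`, and the
solution set is `⋂ y ∈ K, F y`.  The asymptotic cone of a closed convex set consists of recession
directions (`add_smul_mem_of_tendsto_inv_smul`), and so does, for each `y`, the condition
`(-ψ(·, y))^{σg}(u) ≤ 0` (`add_smul_mem_of_genAsymptotic_nonpos`): it says that `u` is a recession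
direction of `{x ∈ K : -ε ≤ ψ x y}` for every `ε > 0`, hence of `F y`.  Thus translating a
solution along an element of `R_σ^E` gives solutions again, which yields one implication; the
inclusion `S(ψ, K)^∞_σ ⊆ R_σ^E` is immediate from the definitions.

It remains to produce a solution when `R_σ^E ⊆ {0}`.  On a compact convex set a solution exists:
pseudomonotonicity and quasi-concavity make `F` a KKM family
(`exists_nonneg_of_mem_convexHull`), and its values are closed and convex.  For such families the
KKM theorem needs no fixed-point theory.  It follows by induction from Berge's intersection theorem
(`iInter_nonempty_of_convex_iUnion`), which in turn rests on the separation of compact convex sets.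
Solutions `x n` on the truncations `K_n` then either stay bounded, and a limit point solves the
problem on `K`, or Condition `(K_σ)` supplies points `w k` which eventually lie in each `F y`.  If
the `w k` are bounded, a limit point is a solution; otherwise, the limit `d ≠ 0` of the directions
`w k / ‖w k‖` belongs to the asymptotic cone of every `F y`, hence to `R_σ^E`, a contradiction.
-/

namespace SigmaEP

/-! ### Intersections of convex sets -/

section Intersection

variable {E ι : Type*} [AddCommGroup E] [Module ℝ E] [TopologicalSpace E]

theorem exists_mem_segment_apply_eq [IsTopologicalAddGroup E] [ContinuousSMul ℝ E]
    (f : E →L[ℝ] ℝ) {p q : E} {c : ℝ} (hp : f p ≤ c) (hq : c ≤ f q) :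
    ∃ z ∈ segment ℝ p q, f z = c := by
  have := (convex_segment (𝕜 := ℝ) p q).isPreconnected.intermediate_value
    (left_mem_segment ℝ p q) (right_mem_segment ℝ p q) f.continuous.continuousOn
  exact this ⟨hp, hq⟩

variable [IsTopologicalAddGroup E] [ContinuousSMul ℝ E] [LocallyConvexSpace ℝ E] [T2Space E]
variable [DecidableEq ι]

/-- **Berge's intersection theorem**: if finitely many compact convex sets have a nonempty convex
union, and all but any one of them have a common point, then all of them have a common point. -/
theorem iInter_nonempty_of_convex_iUnion (s : Finset ι) (C : ι → Set E)
    (hconv : ∀ i ∈ s, Convex ℝ (C i)) (hcomp : ∀ i ∈ s, IsCompact (C i))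
    (hU : Convex ℝ (⋃ i ∈ s, C i)) (hne : (⋃ i ∈ s, C i).Nonempty)
    (hI : ∀ j ∈ s, (⋂ i ∈ s.erase j, C i).Nonempty) : (⋂ i ∈ s, C i).Nonempty := by
  induction s using Finset.induction_on generalizing C with
  | empty => simp at hne
  | insert a s ha ih =>
    rcases s.eq_empty_or_nonempty with rfl | ⟨j₀, hj₀⟩
    · simpa using hne
    by_contra hempty
    rw [Set.not_nonempty_iff_eq_empty, Finset.set_biInter_insert] at hempty
    have hD : (⋂ i ∈ s, C i).Nonempty := by
      simpa [Finset.erase_insert ha] using hI a (Finset.mem_insert_self a s)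
    have hDconv : Convex ℝ (⋂ i ∈ s, C i) :=
      convex_iInter₂ fun i hi => hconv i (Finset.mem_insert_of_mem hi)
    have hDcomp : IsCompact (⋂ i ∈ s, C i) :=
      (hcomp j₀ (Finset.mem_insert_of_mem hj₀)).of_isClosed_subset
        (isClosed_biInter fun i hi => (hcomp i (Finset.mem_insert_of_mem hi)).isClosed)
        (Set.biInter_subset_of_mem hj₀)
    obtain ⟨f, u, v, hu, huv, hv⟩ := geometric_hahn_banach_compact_closed hDconv hDcomp
      (hconv a (Finset.mem_insert_self a s)) (hcomp a (Finset.mem_insert_self a s)).isClosed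
      (Set.disjoint_iff_inter_eq_empty.2 (by rwa [Set.inter_comm]))
    -- The traces of the other sets on the hyperplane `f = u` satisfy the hypotheses again, but
    -- their common points would lie in `⋂ i ∈ s, C i`, which misses that hyperplane.
    have hH : Convex ℝ {x | f x = u} := convex_hyperplane f.isLinear u
    have hHc : IsClosed {x | f x = u} := isClosed_eq f.continuous continuous_const
    obtain ⟨p, hp⟩ := hD
    have hpmem : ∀ i ∈ s, p ∈ C i := by simpa using hp
    have hcross : ∀ j ∈ s, ∃ z, f z = u ∧ (∀ i ∈ s.erase j, z ∈ C i) ∧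
        z ∈ ⋃ i ∈ insert a s, C i := by
      intro j hj
      obtain ⟨q, hq⟩ := hI j (Finset.mem_insert_of_mem hj)
      have hqmem : ∀ i, i ≠ j → i ∈ insert a s → q ∈ C i := by simpa using hq
      have hqa : q ∈ C a :=
        hqmem a (fun h => ha (h ▸ hj)) (Finset.mem_insert_self a s)
      obtain ⟨z, hz, hfz⟩ := exists_mem_segment_apply_eq f (hu p hp).le (huv.trans (hv q hqa)).le
      refine ⟨z, hfz, fun i hi => ?_, ?_⟩
      · have his := Finset.mem_of_mem_erase hi
        exact (hconv i (Finset.mem_insert_of_mem his)).segment_subset (hpmem i his)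
          (hqmem i (Finset.ne_of_mem_erase hi) (Finset.mem_insert_of_mem his)) hz
      · exact hU.segment_subset
          (Set.mem_biUnion (Finset.mem_insert_of_mem hj) (hpmem j hj))
          (Set.mem_biUnion (Finset.mem_insert_self a s) hqa) hz
    have hunion : (⋃ i ∈ s, C i ∩ {x | f x = u}) =
        (⋃ i ∈ insert a s, C i) ∩ {x | f x = u} := by
      ext x
      simp only [Set.mem_iUnion, Set.mem_inter_iff, Set.mem_ofPred_eq, exists_prop]
      constructor
      · rintro ⟨i, hi, hx, hfx⟩
        exact ⟨⟨i, Finset.mem_insert_of_mem hi, hx⟩, hfx⟩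
      · rintro ⟨⟨i, hi, hx⟩, hfx⟩
        rcases Finset.mem_insert.1 hi with rfl | hi
        · exact absurd (hv x hx) (by linarith)
        · exact ⟨i, hi, hx, hfx⟩
    obtain ⟨x, hx⟩ := ih (fun i => C i ∩ {x | f x = u})
      (fun i hi => (hconv i (Finset.mem_insert_of_mem hi)).inter hH)
      (fun i hi => (hcomp i (Finset.mem_insert_of_mem hi)).inter_right hHc)
      (by rw [hunion]; exact hU.inter hH)
      (by
        obtain ⟨z, hfz, -, hz⟩ := hcross j₀ hj₀
        rw [hunion]
        exact ⟨z, hz, hfz⟩)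
      (fun j hj => by
        obtain ⟨z, hfz, hz, -⟩ := hcross j hj
        exact ⟨z, Set.mem_iInter₂.2 fun i hi => ⟨hz i hi, hfz⟩⟩)
    have hx' := Set.mem_iInter₂.1 hx
    exact (hu x (Set.mem_iInter₂.2 fun i hi => (hx' i hi).1)).ne (hx' j₀ hj₀).2

/-- The **KKM theorem** for finitely many closed convex sets.  In the induction on the index set,
Berge's theorem is applied to the traces of the `F i` on the convex hull of the points: their
union is the whole hull. -/
theorem iInter_nonempty_of_convexHull_subset (y : ι → E) (F : ι → Set E) (s : Finset ι)
    (hne : s.Nonempty) (hconv : ∀ i ∈ s, Convex ℝ (F i)) (hclosed : ∀ i ∈ s, IsClosed (F i))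
    (hKKM : ∀ t ⊆ s, convexHull ℝ (y '' t) ⊆ ⋃ i ∈ t, F i) :
    (convexHull ℝ (y '' s) ∩ ⋂ i ∈ s, F i).Nonempty := by
  induction s using Finset.strongInduction with
  | H s ih =>
    have hcomp : IsCompact (convexHull ℝ (y '' s)) :=
      (s.finite_toSet.image y).isCompact_convexHull ℝ
    have hunion : (⋃ i ∈ s, F i ∩ convexHull ℝ (y '' s)) = convexHull ℝ (y '' s) := by
      rw [← Set.iUnion₂_inter]
      exact Set.inter_eq_right.2 (hKKM s subset_rfl)
    obtain ⟨i₀, hi₀⟩ := hne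
    obtain ⟨x, hx⟩ := iInter_nonempty_of_convex_iUnion s
      (fun i => F i ∩ convexHull ℝ (y '' s))
      (fun i hi => (hconv i hi).inter (convex_convexHull ℝ _))
      (fun i hi => hcomp.inter_left (hclosed i hi))
      (by rw [hunion]; exact convex_convexHull ℝ _)
      (by
        rw [hunion]
        exact ⟨y i₀, subset_convexHull ℝ _ (Set.mem_image_of_mem y hi₀)⟩)
      (fun j hj => by
        rcases (s.erase j).eq_empty_or_nonempty with he | he
        · rw [he]
          exact ⟨0, by simp⟩
        · have hsub := Finset.erase_subset j s
          obtain ⟨z, hz, hz'⟩ := ih _ (Finset.erase_ssubset hj) he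
            (fun i hi => hconv i (hsub hi)) (fun i hi => hclosed i (hsub hi))
            (fun t ht => hKKM t (ht.trans hsub))
          exact ⟨z, Set.mem_iInter₂.2 fun i hi => ⟨Set.mem_iInter₂.1 hz' i hi,
            convexHull_mono (Set.image_mono (Finset.coe_subset.2 hsub)) hz⟩⟩)
    have hx' := Set.mem_iInter₂.1 hx
    exact ⟨x, (hx' i₀ hi₀).2, Set.mem_iInter₂.2 fun i hi => (hx' i hi).1⟩

end Intersection

/-! ### Equilibrium problems on compact convex sets -/

section Equilibrium

theorem _root_.UpperSemicontinuousOn.isClosed_superlevel {E : Type*} [TopologicalSpace E]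
    {A : Set E} {f : E → ℝ} (hf : UpperSemicontinuousOn f A) (hA : IsClosed A) (r : ℝ) : IsClosed {x ∈ A | r ≤ f x} := by
  obtain ⟨v, hv, h⟩ := upperSemicontinuousOn_iff_preimage_Ici.1 hf r
  have : {x ∈ A | r ≤ f x} = A ∩ v := h
  rw [this]
  exact hA.inter hv

variable {E : Type*} [AddCommGroup E] [Module ℝ E]

/-- The sets `{x ∈ A : 0 ≤ ψ x y}` have the KKM property: a point `z` with `ψ z y < 0` for all
`y ∈ t` would satisfy `0 < ψ y z` for these `y`, hence `0 < ψ z z` by quasi-concavity. -/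
theorem exists_nonneg_of_mem_convexHull {A : Set E} {ψ : E → E → ℝ}
    (hdiag : ∀ x ∈ A, ψ x x = 0) (hpm : PseudomonotoneOn A (fun x y => -ψ x y))
    (hqc : ∀ y ∈ A, QuasiconcaveOn ℝ A (fun x => ψ x y)) (hA : Convex ℝ A)
    {t : Set E} (ht : t ⊆ A) {z : E} (hz : z ∈ convexHull ℝ t) : ∃ y ∈ t, 0 ≤ ψ z y := by
  have hzA : z ∈ A := convexHull_min ht hA hz
  by_contra! h
  have hsub : t ⊆ {x ∈ A | 0 < ψ x z} := fun y hy => by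
    refine ⟨ht hy, ?_⟩
    by_contra hle
    have := hpm y (ht hy) z hzA (by simpa using hle)
    linarith [h y hy]
  have := (convexHull_min hsub ((hqc z hzA).convex_gt 0) hz).2
  exact this.ne' (hdiag z hzA)

variable [TopologicalSpace E] [IsTopologicalAddGroup E] [ContinuousSMul ℝ E]

/-- An equilibrium problem on a nonempty compact convex set has a solution.  The space need not
be locally convex: for finitely many points `y`, the KKM theorem is applied to the barycentric
coordinates in `ℝ^t`. -/
theorem solutionSet_nonempty_of_isCompact [T2Space E] {A : Set E} {ψ : E → E → ℝ}
    (hne : A.Nonempty) (hcomp : IsCompact A) (hA : Convex ℝ A)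
    (hdiag : ∀ x ∈ A, ψ x x = 0) (hpm : PseudomonotoneOn A (fun x y => -ψ x y))
    (hqc : ∀ y ∈ A, QuasiconcaveOn ℝ A (fun x => ψ x y))
    (husc : ∀ y ∈ A, UpperSemicontinuousOn (fun x => ψ x y) A) :
    (solutionSet ψ A).Nonempty := by
  classical
  have hclosed : ∀ y : A, IsClosed {x ∈ A | 0 ≤ ψ x y} := fun y =>
    (husc y y.2).isClosed_superlevel hcomp.isClosed 0
  obtain ⟨x, hx, hx'⟩ := hcomp.inter_iInter_nonempty (fun y : A => {x ∈ A | 0 ≤ ψ x y}) hclosed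
    (fun t => by
      rcases t.eq_empty_or_nonempty with rfl | ht
      · simpa using hne
      have : Nonempty t := ht.to_subtype
      let L : (t → ℝ) →ₗ[ℝ] E := Fintype.linearCombination ℝ (fun y : t => ((y : A) : E))
      have hL : Continuous L := by
        change Continuous fun l : t → ℝ => ∑ y, l y • ((y : A) : E)
        fun_prop
      obtain ⟨l, -, hl⟩ := iInter_nonempty_of_convexHull_subset
        (fun y : t => (Pi.single y 1 : t → ℝ)) (fun y : t => L ⁻¹' {x ∈ A | 0 ≤ ψ x (y : A)})
        Finset.univ Finset.univ_nonempty
        (fun y _ => (hqc _ (y : A).2 0).linear_preimage L)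
        (fun y _ => (hclosed y).preimage hL)
        (fun r _ l hl => by
          have hLl : L l ∈ convexHull ℝ ((fun y : t => ((y : A) : E)) '' r) := by
            have := Set.mem_image_of_mem L hl
            rw [L.image_convexHull, Set.image_image] at this
            simpa [L, Fintype.linearCombination_apply_single] using this
          have hr : (fun y : t => ((y : A) : E)) '' r ⊆ A := by
            rintro _ ⟨y, -, rfl⟩
            exact (y : A).2
          obtain ⟨_, ⟨y, hy, rfl⟩, h⟩ := exists_nonneg_of_mem_convexHull hdiag hpm hqc hA hr hLl
          exact Set.mem_biUnion hy ⟨convexHull_min hr hA hLl, h⟩)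
      have hl' : ∀ y : t, L l ∈ {x ∈ A | 0 ≤ ψ x (y : A)} := fun y =>
        Set.mem_iInter₂.1 hl y (Finset.mem_univ y)
      exact ⟨L l, (hl' (Classical.arbitrary t)).1,
        Set.mem_iInter₂.2 fun y hy => hl' ⟨y, hy⟩⟩)
  exact ⟨x, hx, fun y hy => (Set.mem_iInter.1 hx' ⟨y, hy⟩).2⟩

/-! ### Asymptotic cones and recession directions -/

/-- Limits of `x k / t k` with `t k → +∞` and `x k` in a closed convex set `C` are recession
directions of `C`. -/
theorem add_smul_mem_of_tendsto_inv_smul {C : Set E} (hC : IsClosed C) (hconv : Convex ℝ C)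
    {t : ℕ → ℝ} {x : ℕ → E} {u : E} (ht : Tendsto t atTop atTop) (hx : ∀ᶠ k in atTop, x k ∈ C)
    (hu : Tendsto (fun k => (t k)⁻¹ • x k) atTop (𝓝 u)) {a : E} (ha : a ∈ C) {r : ℝ}
    (hr : 0 ≤ r) : a + r • u ∈ C := by
  have hinv : Tendsto (fun k => (t k)⁻¹) atTop (𝓝 0) := tendsto_inv_atTop_zero.comp ht
  have hlim : Tendsto (fun k => (1 - r * (t k)⁻¹) • a + r • ((t k)⁻¹ • x k)) atTop
      (𝓝 ((1 - r * 0) • a + r • u)) :=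
    ((tendsto_const_nhds.sub (hinv.const_mul r)).smul tendsto_const_nhds).add
      (hu.const_smul r)
  have hmem := hC.mem_of_tendsto hlim (by
    filter_upwards [ht.eventually_ge_atTop (max r 1), hx] with k hk hxk
    have hpos : 0 < t k := lt_of_lt_of_le one_pos ((le_max_right r 1).trans hk)
    rw [smul_smul]
    refine hconv ha hxk ?_ (by positivity) (by ring)
    have : r * (t k)⁻¹ ≤ 1 := by
      rw [← div_eq_mul_inv, div_le_one hpos]
      exact (le_max_left r 1).trans hk
    linarith)
  simpa using hmem

end Equilibrium

section Cone

variable {X : Type*} [NormedAddCommGroup X] [NormedSpace ℝ X]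

theorem asymptoticCone_mono (σ : TopologicalSpace X) {A B : Set X} (h : A ⊆ B) :
    asymptoticCone σ A ⊆ asymptoticCone σ B := by
  rintro u ⟨t, x, ht, hx, hu⟩
  exact ⟨t, x, ht, fun k => h (hx k), hu⟩

theorem mem_asymptoticCone_of_eventually (σ : TopologicalSpace X) {A : Set X} {t : ℕ → ℝ}
    {x : ℕ → X} {u : X} (ht : Tendsto t atTop atTop) (hx : ∀ᶠ k in atTop, x k ∈ A)
    (hu : Tendsto (fun k => (t k)⁻¹ • x k) atTop (@nhds X σ u)) : u ∈ asymptoticCone σ A := by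
  obtain ⟨N, hN⟩ := eventually_atTop.1 hx
  have hshift : Tendsto (fun k => k + N) atTop atTop := tendsto_add_atTop_nat N
  exact ⟨fun k => t (k + N), fun k => x (k + N), ht.comp hshift,
    fun k => hN _ (Nat.le_add_left N k), hu.comp hshift⟩

/-- A recession direction of a nonempty set belongs to its asymptotic cone. -/
theorem mem_asymptoticCone_of_add_smul_mem (σ : TopologicalSpace X)
    (hσ_add : @IsTopologicalAddGroup X σ _) (hσ_smul : @ContinuousSMul ℝ X _ _ σ)
    {A : Set X} {a u : X} (h : ∀ r : ℝ, 0 ≤ r → a + r • u ∈ A) : u ∈ asymptoticCone σ A := by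
  let := σ
  refine ⟨fun k => (k : ℝ) + 1, fun k => a + ((k : ℝ) + 1) • u,
    tendsto_natCast_atTop_atTop.atTop_add tendsto_const_nhds, fun k => h _ (by positivity), ?_⟩
  have hinv : Tendsto (fun k : ℕ => ((k : ℝ) + 1)⁻¹) atTop (𝓝 0) :=
    tendsto_inv_atTop_zero.comp
      (tendsto_natCast_atTop_atTop.atTop_add tendsto_const_nhds)
  have hlim : Tendsto (fun k : ℕ => ((k : ℝ) + 1)⁻¹ • a + u) atTop (@nhds X σ ((0 : ℝ) • a + u)) :=
    (hinv.smul tendsto_const_nhds).add tendsto_const_nhds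
  rw [zero_smul, zero_add] at hlim
  refine hlim.congr fun k => ?_
  rw [smul_add, smul_smul, inv_mul_cancel₀ (by positivity), one_smul]

theorem setOf_extendTop_le {X : Type*} (K : Set X) (f : X → ℝ) (r : ℝ) :
    {x | extendTop K f x ≤ (r : EReal)} = {x ∈ K | f x ≤ r} := by
  ext x
  by_cases hx : x ∈ K <;> simp [extendTop, hx]

theorem genAsymptotic_nonpos_of_mem (σ : TopologicalSpace X) {K : Set X} {g : X → ℝ} {u : X}
    (hu : u ∈ asymptoticCone σ {x ∈ K | 0 ≤ g x}) :
    genAsymptotic σ (extendTop K (fun x => -g x)) u ≤ 0 := by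
  refine (iInf₂_le (0 : ℝ) ?_).trans_eq EReal.coe_zero
  rw [setOf_extendTop_le]
  simpa using hu

/-- If `(-g)^{σg}(u) ≤ 0`, then `u` is a recession direction of `{x ∈ K : 0 ≤ g x}`, the
intersection of the closed convex sets `{x ∈ K : -r ≤ g x}` with `r > 0`. -/
theorem add_smul_mem_of_genAsymptotic_nonpos (σ : TopologicalSpace X)
    (hσ_add : @IsTopologicalAddGroup X σ _) (hσ_smul : @ContinuousSMul ℝ X _ _ σ)
    {K : Set X} (hK : @IsClosed X σ K) {g : X → ℝ} (hqc : QuasiconcaveOn ℝ K g)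
    (husc : @UpperSemicontinuousOn X ℝ σ _ g K) {u : X}
    (hu : genAsymptotic σ (extendTop K (fun x => -g x)) u ≤ 0) {a : X} (ha : a ∈ K)
    (hga : 0 ≤ g a) {s : ℝ} (hs : 0 ≤ s) : a + s • u ∈ {x ∈ K | 0 ≤ g x} := by
  let := σ
  have key : ∀ ε : ℝ, 0 < ε → a + s • u ∈ {x ∈ K | -ε ≤ g x} := by
    intro ε hε
    have hlt : genAsymptotic σ (extendTop K (fun x => -g x)) u < (ε : EReal) :=
      hu.trans_lt (by exact_mod_cast hε)
    obtain ⟨r, hr⟩ := iInf_lt_iff.1 hlt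
    obtain ⟨hmem, hr⟩ := iInf_lt_iff.1 hr
    have hrε : r < ε := by exact_mod_cast hr
    rw [setOf_extendTop_le] at hmem
    obtain ⟨t, x, ht, hx, hlim⟩ := hmem
    exact add_smul_mem_of_tendsto_inv_smul (husc.isClosed_superlevel hK (-ε)) (hqc (-ε)) ht
      (Eventually.of_forall fun k => ⟨(hx k).1, by linarith [(hx k).2]⟩) hlim
      ⟨ha, by linarith⟩ hs
  refine ⟨(key 1 one_pos).1, le_of_forall_pos_le_add fun ε hε => ?_⟩
  linarith [(key ε hε).2]

end Cone

/-! ### Existence of solutions on unbounded sets -/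

section Existence

variable {X : Type*} [NormedAddCommGroup X] [NormedSpace ℝ X]

theorem exists_subseq_tendsto_of_norm_le (σ : TopologicalSpace X)
    (hσ_smul : @ContinuousSMul ℝ X _ _ σ)
    (hB_seq : @IsSeqCompact X σ (Metric.closedBall (0 : X) 1)) {M : ℝ} (hM : 0 < M)
    {x : ℕ → X} (hx : ∀ n, ‖x n‖ ≤ M) :
    ∃ (a : X) (φ : ℕ → ℕ), StrictMono φ ∧ Tendsto (x ∘ φ) atTop (@nhds X σ a) := by
  let := σ
  obtain ⟨a, -, φ, hφ, hlim⟩ := hB_seq (x := fun n => M⁻¹ • x n) (fun n => by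
    rw [mem_closedBall_zero_iff, norm_smul, norm_inv, Real.norm_of_nonneg hM.le,
      inv_mul_le_one₀ hM]
    exact hx n)
  refine ⟨M • a, φ, hφ, (hlim.const_smul M).congr fun n => ?_⟩
  simp [smul_smul, hM.ne']

theorem convex_truncation {K : Set X} (hK : Convex ℝ K) (n : ℕ) :
    Convex ℝ (truncation K n) := by
  have : truncation K n = K ∩ Metric.closedBall 0 n := by
    ext; simp [truncation]
  rw [this]
  exact hK.inter (convex_closedBall 0 _)

open Pointwise in
theorem isCompact_truncation (σ : TopologicalSpace X) (hσ_smul : @ContinuousSMul ℝ X _ _ σ)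
    (hB : @IsCompact X σ (Metric.closedBall (0 : X) 1)) {K : Set X} (hK : @IsClosed X σ K)
    (n : ℕ) : @IsCompact X σ (truncation K n) := by
  have h : truncation K n = ((n : ℝ) • Metric.closedBall (0 : X) 1) ∩ K := by
    rw [smul_unitClosedBall_of_nonneg n.cast_nonneg]
    ext; simp [truncation, and_comm]
  let := σ
  rw [h, ← Set.image_smul]
  exact (hB.image (continuous_const_smul (n : ℝ))).inter_right hK

/-- A bounded sequence in `K` which eventually lies in each set `{x ∈ K : 0 ≤ ψ x y}` yields a
solution, namely any sequential limit point. -/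
theorem solutionSet_nonempty_of_bounded (σ : TopologicalSpace X)
    (hσ_smul : @ContinuousSMul ℝ X _ _ σ)
    (hB_seq : @IsSeqCompact X σ (Metric.closedBall (0 : X) 1))
    {K : Set X} (hK : @IsClosed X σ K) {ψ : X → X → ℝ}
    (husc : ∀ y ∈ K, @UpperSemicontinuousOn X ℝ σ _ (fun x => ψ x y) K)
    {x : ℕ → X} (hxK : ∀ n, x n ∈ K) (hx : ∀ y ∈ K, ∀ᶠ n in atTop, 0 ≤ ψ (x n) y)
    (hbdd : Bornology.IsBounded (Set.range x)) : (solutionSet ψ K).Nonempty := by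
  obtain ⟨M, hM, hle⟩ := hbdd.exists_pos_norm_le
  obtain ⟨a, φ, hφ, hlim⟩ := exists_subseq_tendsto_of_norm_le σ hσ_smul hB_seq hM
    (fun n => hle _ (Set.mem_range_self n))
  let := σ
  refine ⟨a, hK.mem_of_tendsto hlim (Eventually.of_forall fun n => hxK _), fun y hy => ?_⟩
  exact (((husc y hy).isClosed_superlevel hK 0).mem_of_tendsto hlim
    ((hφ.tendsto_atTop.eventually (hx y hy)).mono fun n hn => ⟨hxK _, hn⟩)).2

theorem exists_subseq_norm_tendsto_atTop {X : Type*} [SeminormedAddCommGroup X] {w : ℕ → X}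
    (hw : ¬ Bornology.IsBounded (Set.range w)) :
    ∃ φ : ℕ → ℕ, StrictMono φ ∧ Tendsto (fun k => ‖w (φ k)‖) atTop atTop := by
  have hfreq : ∀ N : ℕ, ∃ᶠ k in atTop, (N : ℝ) < ‖w k‖ := by
    intro N
    rw [Filter.frequently_atTop]
    by_contra! h
    obtain ⟨a, ha⟩ := h
    refine hw (((Set.finite_lt_nat a).image w).isBounded.union
      (Metric.isBounded_closedBall (x := (0 : X)) (r := N)) |>.subset ?_)
    rintro _ ⟨k, rfl⟩
    rcases lt_or_ge k a with hk | hk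
    · exact Or.inl ⟨k, hk, rfl⟩
    · exact Or.inr (by simpa using ha k hk)
  obtain ⟨φ, hφ, h⟩ := extraction_forall_of_frequently hfreq
  exact ⟨φ, hφ, tendsto_atTop_mono (fun k => (h k).le) tendsto_natCast_atTop_atTop⟩

end Existence

end SigmaEP

theorem mainTheorem3 {X : Type*} [NormedAddCommGroup X] [NormedSpace ℝ X]
    -- a Hausdorff vector topology coarser than the norm topology
    (σ : TopologicalSpace X)
    (hσ_coarser : (PseudoMetricSpace.toUniformSpace (α := X)).toTopologicalSpace ≤ σ)
    (hσ_t2 : @T2Space X σ)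
    (hσ_add : @IsTopologicalAddGroup X σ _)
    (hσ_smul : @ContinuousSMul ℝ X _ _ σ)
    -- the closed unit ball is sequentially compact and compact for it
    (hB_seq : @IsSeqCompact X σ (Metric.closedBall (0 : X) 1))
    (hB : @IsCompact X σ (Metric.closedBall (0 : X) 1))
    (K : Set X) (hK_ne : K.Nonempty) (hK_closed : @IsClosed X σ K) (hK_conv : Convex ℝ K)
    (ψ : X → X → ℝ)
    (hψ_K : SigmaEP.ConditionK σ K ψ)
    (hψ_diag : ∀ x ∈ K, ψ x x = 0)
    (hψ_pm : SigmaEP.PseudomonotoneOn K (fun x y => -ψ x y))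
    (hψ_qc : ∀ y ∈ K, QuasiconcaveOn ℝ K (fun x => ψ x y))
    (hψ_usc : ∀ y ∈ K, @UpperSemicontinuousOn X ℝ σ _ (fun x => ψ x y) K) :
    SigmaEP.recessionSet σ K ψ ⊆ {0} ↔
      (SigmaEP.solutionSet ψ K).Nonempty ∧
        SigmaEP.asymptoticCone σ (SigmaEP.solutionSet ψ K) = {0} := by
  constructor
  · intro hR
    have hS : (SigmaEP.solutionSet ψ K).Nonempty := by
      have hn : ∀ n, (SigmaEP.truncation K n).Nonempty →
          (SigmaEP.solutionSet ψ (SigmaEP.truncation K n)).Nonempty := by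
        intro n hne
        have hsub : SigmaEP.truncation K n ⊆ K := fun x hx => hx.1
        have hconv := SigmaEP.convex_truncation hK_conv n
        have hcomp := SigmaEP.isCompact_truncation σ hσ_smul hB hK_closed n
        let := σ
        exact SigmaEP.solutionSet_nonempty_of_isCompact hne hcomp hconv
          (fun x hx => hψ_diag x hx.1) (fun x hx y hy => hψ_pm x hx.1 y hy.1)
          (fun y hy => hconv.quasiconcaveOn_restrict (hψ_qc y hy.1) hsub)
          (fun y hy => (hψ_usc y hy.1).mono hsub)
      -- The finitely many `n` with empty truncation get an arbitrary point of `K`.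
      have hex : ∀ n, ∃ x ∈ K, (SigmaEP.truncation K n).Nonempty →
          x ∈ SigmaEP.solutionSet ψ (SigmaEP.truncation K n) := by
        intro n
        by_cases hne : (SigmaEP.truncation K n).Nonempty
        · obtain ⟨x, hx⟩ := hn n hne
          exact ⟨x, hx.1.1, fun _ => hx⟩
        · exact ⟨hK_ne.some, hK_ne.some_mem, fun h => absurd h hne⟩
      choose x hxK hx using hex
      have htrunc : ∀ y ∈ K, ∀ᶠ n : ℕ in atTop, y ∈ SigmaEP.truncation K n := fun y hy =>
        (tendsto_natCast_atTop_atTop.eventually_ge_atTop ‖y‖).mono fun n hn => ⟨hy, hn⟩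
      have hxψ : ∀ y ∈ K, ∀ᶠ n in atTop, 0 ≤ ψ (x n) y := fun y hy =>
        (htrunc y hy).mono fun n hyn => (hx n ⟨y, hyn⟩).2 y hyn
      by_cases hxb : Bornology.IsBounded (Set.range x)
      · exact SigmaEP.solutionSet_nonempty_of_bounded σ hσ_smul hB_seq hK_closed hψ_usc hxK hxψ hxb
      obtain ⟨φ, w, d, hφ, -, hw, hdK, hd, hle, hlim⟩ := hψ_K x hxK (fun n _ => hx n) hxb
      have hwψ : ∀ y ∈ K, ∀ᶠ k in atTop, 0 ≤ ψ (w k) y := fun y hy => by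
        filter_upwards [hφ.tendsto_atTop.eventually (hxψ y hy),
          hφ.tendsto_atTop.eventually (htrunc y hy)] with k hk hyk
        exact hk.trans (hle k y hyk)
      -- Nothing in Condition `(K_σ)` forces the norms of the `w k` to be unbounded.
      by_cases hwb : Bornology.IsBounded (Set.range w)
      · exact SigmaEP.solutionSet_nonempty_of_bounded σ hσ_smul hB_seq hK_closed hψ_usc
          (fun k => (hw k).1) hwψ hwb
      obtain ⟨θ, hθ, hθw⟩ := SigmaEP.exists_subseq_norm_tendsto_atTop hwb
      refine absurd (hR ⟨hdK, fun y hy => SigmaEP.genAsymptotic_nonpos_of_mem σ ?_⟩) hd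
      exact SigmaEP.mem_asymptoticCone_of_eventually σ hθw
        ((hθ.tendsto_atTop.eventually (hwψ y hy)).mono fun k hk => ⟨(hw _).1, hk⟩)
        (hlim.comp hθ.tendsto_atTop)
    refine ⟨hS, Set.Subset.antisymm (fun u hu => hR ⟨?_, fun y hy => ?_⟩) ?_⟩
    · exact SigmaEP.asymptoticCone_mono σ (fun x hx => hx.1) hu
    · have hsub : SigmaEP.solutionSet ψ K ⊆ {x ∈ K | 0 ≤ ψ x y} := fun x hx => ⟨hx.1, hx.2 y hy⟩
      exact SigmaEP.genAsymptotic_nonpos_of_mem σ (SigmaEP.asymptoticCone_mono σ hsub hu)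
    -- The cone contains `0` because the solution set is nonempty.
    · obtain ⟨a, ha⟩ := hS
      rintro _ rfl
      exact SigmaEP.mem_asymptoticCone_of_add_smul_mem σ hσ_add hσ_smul (a := a)
        (fun r _ => by simpa using ha)
  · rintro ⟨⟨a, ha⟩, hcone⟩ u ⟨-, hu⟩
    rw [← hcone]
    have hmem : ∀ y ∈ K, ∀ r : ℝ, 0 ≤ r → a + r • u ∈ {x ∈ K | 0 ≤ ψ x y} := fun y hy r hr =>
      SigmaEP.add_smul_mem_of_genAsymptotic_nonpos σ hσ_add hσ_smul hK_closed (hψ_qc y hy)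
        (hψ_usc y hy) (hu y hy) ha.1 (ha.2 y hy) hr
    refine SigmaEP.mem_asymptoticCone_of_add_smul_mem σ hσ_add hσ_smul (a := a) fun r hr => ?_
    exact ⟨(hmem a ha.1 r hr).1, fun y hy => (hmem y hy r hr).2⟩
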